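/- Let $D_n$ be the dihedral group of order $2n$, i.e. the set of pairs $(k,\epsilon)$ with $k\in\mathbb{Z}_n$, $\epsilon=\pm1$, with product $(k,\epsilon)(l,\eta)=(k+\epsilon l,\epsilon\eta)$, and let $\pi(k,\epsilon)=k$. For $A\subseteq\mathbb{Z}_n$ let $\mathbf{iv}(A)(k)=\#\{(a,b)\in A^2 : b-a=k\}$. Two subsets $A,B$ of $\mathbb{Z}_n$ are (non-trivially) homometric if $\mathbf{iv}(A)=\mathbf{iv}(B)$ and there is no $p\in\mathbb{Z}_n$ with $B=p+A$ or $B=p-A$. For $\mathcal{A}\subseteq D_n$ let ${}^r\mathbf{iv}(\mathcal{A})(g)=\#\{(x,y)\in\mathcal{A}^2 : xg=y\}$. Two subsets $\mathcal{A},\mathcal{B}$ of $D_n$ are (non-trivially) right-homometric if ${}^r\mathbf{iv}(\mathcal{A})={}^r\mathbf{iv}(\mathcal{B})$ and there is no $g\in D_n$ with $g\mathcal{A}=\mathcal{B}$. A lift is a map $l:\mathcal{P}(\mathbb{Z}_n)\to\mathcal{P}(D_n)$ with $\pi(l(A))=A$ for every $A\subseteq\mathbb{Z}_n$. **Corollary.**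 Let $N\ge2$ and let $A,B\subseteq\mathbb{Z}_{4N}$ be non-trivially homometric sets of cardinality $4$. Then there is a lift $l$ such that $l(A)$ and $l(B)$ are non-trivially right-homometric subsets of $D_{4N}$ with $4$ elements each (so every element of $A$ and of $B$ receives exactly one sign). Moreover, if the differences of elements of $A$ do not all lie in the subgroup $\{d\in\mathbb{Z}_{4N} : 13d=0\}$, then $l$ can be chosen such that in addition each of $l(A)$ and $l(B)$ has exactly two elements with $\epsilon=1$ and exactly two with $\epsilon=-1$. -/

import Mathlib

namespace Homometry

/-! Homometry in the cyclic group `ZMod n`. -/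

/-- `ifunc(A, B)(k)`: the number of pairs `(a, b)` in `A × B` with `b - a = k`. -/
def ifunc {n : ℕ} (A B : Finset (ZMod n)) (k : ZMod n) : ℕ :=
  ((A ×ˢ B).filter (fun p => p.2 - p.1 = k)).card

/-- The interval vector `iv(A) = ifunc(A, A)`. -/
def iv {n : ℕ} (A : Finset (ZMod n)) : ZMod n → ℕ := ifunc A A

/-- The transposition `T_p(A) = p + A`. -/
def transposition {n : ℕ} (p : ZMod n) (A : Finset (ZMod n)) : Finset (ZMod n) :=
  A.image (fun x => p + x)

/-- The inversion `I_p(A) = p - A`. -/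
def inversion {n : ℕ} (p : ZMod n) (A : Finset (ZMod n)) : Finset (ZMod n) :=
  A.image (fun x => -x + p)

/-- Equal interval vectors, and not in the same class modulo transpositions and inversions. -/
def NontriviallyHomometric {n : ℕ} (A B : Finset (ZMod n)) : Prop :=
  iv A = iv B ∧ ¬ ∃ p : ZMod n, transposition p A = B ∨ inversion p A = B

/-! The dihedral group of order `2n` as a semidirect product of `ZMod n` and `{1, -1}`. -/

/-- Elements of the dihedral group: pairs `(k, ε)` with `k` in `ZMod n` and `ε = ±1`. -/
@[ext]
structure Dih (n : ℕ) where
  /-- The first projection `π`. -/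
  proj : ZMod n
  /-- The sign. -/
  sign : ℤˣ
deriving DecidableEq

namespace Dih

variable {n : ℕ}

/-- The action of a sign on `ZMod n`. -/
def act (ε : ℤˣ) (k : ZMod n) : ZMod n := ((ε : ℤ) : ZMod n) * k

theorem act_one (k : ZMod n) : act 1 k = k := by simp [act]

theorem act_neg_one (k : ZMod n) : act (-1) k = -k := by simp [act]

/-- `(k, ε)(l, η) = (k + ε l, ε η)`. -/
instance : Mul (Dih n) := ⟨fun x y => ⟨x.proj + act x.sign y.proj, x.sign * y.sign⟩⟩

instance : One (Dih n) := ⟨⟨0, 1⟩⟩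

/-- `(k, ε)⁻¹ = (-ε k, ε)`. -/
instance : Inv (Dih n) := ⟨fun x => ⟨-act x.sign x.proj, x.sign⟩⟩

theorem mul_def (x y : Dih n) :
    x * y = ⟨x.proj + act x.sign y.proj, x.sign * y.sign⟩ := rfl

theorem one_def : (1 : Dih n) = ⟨0, 1⟩ := rfl

theorem inv_def (x : Dih n) : x⁻¹ = ⟨-act x.sign x.proj, x.sign⟩ := rfl

instance : Group (Dih n) :=
  Group.ofLeftAxioms
    (by
      intro x y z
      simp only [mul_def, act, mul_assoc]
      congr 1
      push_cast
      ring)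
    (by
      intro x
      simp [mul_def, one_def, act])
    (by
      intro x
      simp only [mul_def, one_def, inv_def]
      congr 1
      · ring
      · exact Int.units_mul_self x.sign)

/-- The right interval from `(k₁, ε₁)` to `(k₂, ε₂)`: `((k₂ - k₁) / ε₁, ε₂ / ε₁)`. -/
def rightInt (x y : Dih n) : Dih n := ⟨act (x.sign)⁻¹ (y.proj - x.proj), y.sign / x.sign⟩

/-- The right interval is the unique `g` with `x * g = y`. -/
theorem mul_eq_iff_eq_rightInt (x y g : Dih n) : x * g = y ↔ g = rightInt x y := by
  have h : rightInt x y = x⁻¹ * y := by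
    simp only [rightInt, mul_def, inv_def, act, Int.units_inv_eq_self]
    congr 1
    · ring
    · rw [div_eq_mul_inv, Int.units_inv_eq_self, mul_comm]
  rw [h, eq_inv_mul_iff_mul_eq]

/-- The right interval vector of a set in the dihedral group. -/
def rightIv (S : Finset (Dih n)) (g : Dih n) : ℕ :=
  ((S ×ˢ S).filter (fun p => rightInt p.1 p.2 = g)).card

/-- Equal right interval vectors, and not linked by a left translation
(left translations preserve all right intervals). -/
def NontriviallyRightHomometric (S T : Finset (Dih n)) : Prop :=
  rightIv S = rightIv T ∧ ¬ ∃ g : Dih n, S.image (fun x => g * x) = T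

/-- A lift: a map `l` from the subsets of `ZMod n` to the subsets of the dihedral group with
`π ∘ l = id`. For `n ≠ 0` both groups are finite, so that `Finset` is the power set. -/
def IsLift (l : Finset (ZMod n) → Finset (Dih n)) : Prop :=
  ∀ A, (l A).image proj = A

/-- The elements of `S` with sign `ε`. -/
def signPart (ε : ℤˣ) (S : Finset (Dih n)) : Finset (Dih n) :=
  S.filter (fun x => x.sign = ε)

end Dih

end Homometry

/-!
Why the theorem holds. Left translations of the dihedral group project to transpositions and
inversions (`congruent_of_left_translate`), so any lifts with equal right interval vectors are
non-trivially right-homometric (`nontriviallyRightHomometric_of_proj`). It remains to choose signs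
that make the right interval vectors agree. Giving the sign `1` to every element always does, since
the right intervals are then the ordinary ones. Balanced signs need a classification of homometric
quadruples (`thirteen_or_quarter`): if the differences are not all killed by `13`, one of `A`, `B`
is a quarter set `{u, u + 2k, w, w + k}` with `4k = 0`. Then so is the other one, with the same `k`
and with the same `w - u` up to sign and modulo `k` (`exists_quarter_form`). If `u`, `u + 2k` receive
one sign and `w`, `w + k` the other, the intervals between equal signs depend only on `k`, and those
between opposite signs run twice through the coset of `±(w - u)` modulo `k`, the sign depending on
which pair is positive. So the right interval vectors can be made to agree.

For the classification, view `A` and `B` as complete graphs on four vertices with edges labelled by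
differences up to sign. Equality of the interval vectors gives a bijection of edges preserving labels
(`exists_perm_edgeDiff`). If `A` and `B` contain congruent triangles, move `B` so that the triangles
coincide; matching the three remaining labels shows that `A` and `B` are congruent or that `A` is a
quarter set (`quarter_or_congruent_of_triangle`). Otherwise each triangle of `A` corresponds to a star
or a path of `B`. As the sides of a triangle have a vanishing signed sum, one gets a linear relation
among the points of `B`; all choices of signs but one would produce a shared triangle
(`barycentre_of_star`, `eq_two_mul_of_path`). There are three possible patterns of stars and paths
(`trianglePattern_perm`): four stars contradict the absence of shared triangles, two paths
with the same ends make `B` a quarter set, and three paths with the same starting point make the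
differences of `B` vanish after multiplication by `13`. The only fact about `ZMod n` used beyond
its ring structure is that it has at most one element of order `2`.
-/

/-! ### Matchings between the edges of two complete graphs on four vertices -/

namespace Homometry

/-- The index of the edge `{i, j}` of the complete graph on `Fin 4`, the edges being
enumerated as `01, 02, 03, 12, 13, 23`; the diagonal carries a junk value. -/
def edge : Fin 4 → Fin 4 → Fin 6 :=
  ![![0, 0, 1, 2], ![0, 0, 3, 4], ![1, 3, 0, 5], ![2, 4, 5, 0]]

/-- The edges `x`, `y`, `z` of the complete graph on `Fin 4` form a triangle. -/
def IsTriangle (x y z : Fin 6) : Prop :=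
  ∃ p q r : Fin 4, p ≠ q ∧ q ≠ r ∧ r ≠ p ∧ x = edge p q ∧ y = edge q r ∧ z = edge r p

/-- Encoding a set of edges by its bit mask, the four triangles are `11`, `21`, `38` and `56`. -/
theorem isTriangle_iff_mask : ∀ x y z : Fin 6,
    2 ^ x.val + 2 ^ y.val + 2 ^ z.val ∈ [11, 21, 38, 56] ↔ IsTriangle x y z := by
  unfold IsTriangle
  decide +kernel

instance (x y z : Fin 6) : Decidable (IsTriangle x y z) :=
  decidable_of_iff _ (isTriangle_iff_mask x y z)

/-- How the triangles of a complete graph on `Fin 4` can lie in another one when the edges of the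
second are matched with those of the first by `t`: some triangle corresponds to a triangle, or the
edge triples corresponding to triangles are the four stars, or they include two paths with the same
ends or three paths with the same starting point. -/
def TrianglePattern (t : Fin 6 → Fin 6) : Prop :=
  (∃ i j : Fin 4, i < j ∧ ∃ k, j < k ∧
    IsTriangle (t (edge i j)) (t (edge j k)) (t (edge k i))) ∨
  (IsTriangle (t (edge 0 1)) (t (edge 0 2)) (t (edge 0 3)) ∧
    IsTriangle (t (edge 1 0)) (t (edge 1 2)) (t (edge 1 3)) ∧
    IsTriangle (t (edge 2 0)) (t (edge 2 1)) (t (edge 2 3)) ∧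
    IsTriangle (t (edge 3 0)) (t (edge 3 1)) (t (edge 3 2))) ∨
  ∃ i j : Fin 4, i ≠ j ∧ ∃ k, i ≠ k ∧ j ≠ k ∧ ∃ l, i ≠ l ∧ j ≠ l ∧ k ≠ l ∧
    IsTriangle (t (edge i k)) (t (edge k l)) (t (edge l j)) ∧
    (IsTriangle (t (edge i l)) (t (edge l k)) (t (edge k j)) ∨
      IsTriangle (t (edge i j)) (t (edge j k)) (t (edge k l)) ∧
      IsTriangle (t (edge i l)) (t (edge l j)) (t (edge j k)))

instance (t : Fin 6 → Fin 6) : Decidable (TrianglePattern t) := by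
  unfold TrianglePattern
  infer_instance

set_option synthInstance.maxHeartbeats 400000 in
set_option synthInstance.maxSize 1000 in
/-- A check over the `720` bijections, enumerated value by value. -/
theorem trianglePattern_of_distinct :
    ∀ s₀ s₁ : Fin 6, s₀ ≠ s₁ → ∀ s₂, s₀ ≠ s₂ → s₁ ≠ s₂ →
    ∀ s₃, s₀ ≠ s₃ → s₁ ≠ s₃ → s₂ ≠ s₃ →
    ∀ s₄, s₀ ≠ s₄ → s₁ ≠ s₄ → s₂ ≠ s₄ → s₃ ≠ s₄ →
    ∀ s₅, s₀ ≠ s₅ → s₁ ≠ s₅ → s₂ ≠ s₅ → s₃ ≠ s₅ → s₄ ≠ s₅ →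
      TrianglePattern ![s₀, s₁, s₂, s₃, s₄, s₅] := by
  decide +kernel

theorem trianglePattern_perm (τ : Equiv.Perm (Fin 6)) : TrianglePattern τ := by
  have h : (τ : Fin 6 → Fin 6) = ![τ 0, τ 1, τ 2, τ 3, τ 4, τ 5] := by
    funext i; fin_cases i <;> rfl
  rw [h]
  apply trianglePattern_of_distinct <;> simp [τ.injective.eq_iff]

end Homometry

/-! ### Interval vectors, transpositions and inversions -/

namespace Homometry

variable {n : ℕ}

/-- Equality up to a sign. -/
def UpToSign (x y : ZMod n) : Prop := x = y ∨ x = -y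

/-- The indicator of `x = c`, as a natural number. A named function, so that `x` can be rewritten
without touching a decidability instance. -/
def hit (x c : ZMod n) : ℕ := if x = c then 1 else 0

/-- A family of differences is determined by its multiset up to signs and order. -/
theorem exists_perm_upToSign {ι : Type*} [Fintype ι] [DecidableEq ι] (f g : ι → ZMod n)
    (h : ∀ c, ∑ i, (hit (f i) c + hit (-f i) c) = ∑ i, (hit (g i) c + hit (-g i) c)) :
    ∃ σ : Equiv.Perm ι, ∀ i, UpToSign (f i) (g (σ i)) := by
  classical
  let L : ZMod n → Finset (ZMod n) := fun x => {x, -x}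
  have hL : ∀ x y, L x = L y ↔ UpToSign x y := by
    intro x y
    constructor
    · intro e
      have : x ∈ L y := e ▸ (by simp [L])
      simpa [L, UpToSign] using this
    · rintro (rfl | rfl)
      · rfl
      · simp [L, Finset.pair_comm]
  -- a class `{c, -c}` has as many representatives in one family as in the other
  have count : ∀ (u : ι → ZMod n) (c : ZMod n),
      ∑ i, (hit (u i) c + hit (-u i) c) =
        (if c = -c then 2 else 1) * (Finset.univ.filter fun i => L (u i) = L c).card := by
    intro u c
    rw [Finset.card_filter, Finset.mul_sum]
    refine Finset.sum_congr rfl fun i _ => ?_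
    simp only [hL, UpToSign, hit]
    by_cases hc : c = -c
    · have h1 : -u i = c ↔ u i = c := by rw [neg_eq_iff_eq_neg, ← hc]
      have h2 : u i = -c ↔ u i = c := by rw [← hc]
      by_cases h3 : u i = c <;> simp [← hc, h1, h3]
    · have h1 : -u i = c ↔ u i = -c := neg_eq_iff_eq_neg
      by_cases h3 : u i = c
      · have : -c ≠ c := fun h => hc h.symm
        simp [h3, hc, this]
      · by_cases h4 : u i = -c
        · have : -c ≠ c := fun h => hc h.symm
          simp [h4, hc, this]
        · simp [h1, h3, h4]
  have card_eq : ∀ c : ZMod n, (Finset.univ.filter fun i => L (f i) = L c).card =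
      (Finset.univ.filter fun i => L (g i) = L c).card := by
    intro c
    have := h c
    rw [count, count] at this
    exact Nat.eq_of_mul_eq_mul_left (by split_ifs <;> norm_num) this
  have fib : ∀ s : Finset (ZMod n),
      Nonempty ({i // L (f i) = s} ≃ {i // L (g i) = s}) := by
    intro s
    by_cases hs : ∃ c, s = L c
    · obtain ⟨c, rfl⟩ := hs
      refine ⟨Fintype.equivOfCardEq ?_⟩
      rw [Fintype.card_subtype, Fintype.card_subtype]
      exact card_eq c
    · push Not at hs
      have : IsEmpty {i // L (f i) = s} := ⟨fun i => hs _ i.2.symm⟩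
      have : IsEmpty {i // L (g i) = s} := ⟨fun i => hs _ i.2.symm⟩
      exact ⟨Equiv.equivOfIsEmpty _ _⟩
  let F := fun s => (fib s).some
  refine ⟨Equiv.ofFiberEquiv (f := fun i => L (f i)) (g := fun i => L (g i)) F, fun i => ?_⟩
  rw [← hL]
  exact (Equiv.ofFiberEquiv_map (f := fun i => L (f i)) (g := fun i => L (g i)) F i).symm

theorem iv_image {ι : Type*} [Fintype ι] (a : ι → ZMod n) (ha : Function.Injective a)
    (c : ZMod n) :
    iv (Finset.univ.image a) c = ∑ i, ∑ j, hit (a j - a i) c := by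
  rw [iv, ifunc, Finset.card_filter, Finset.sum_product,
    Finset.sum_image fun x _ y _ h => ha h]
  refine Finset.sum_congr rfl fun i _ => ?_
  rw [Finset.sum_image fun x _ y _ h => ha h]
  rfl

theorem iv_pos_iff (A : Finset (ZMod n)) (c : ZMod n) :
    0 < iv A c ↔ ∃ x ∈ A, ∃ y ∈ A, y - x = c := by
  rw [iv, ifunc, Finset.card_pos]
  constructor
  · rintro ⟨⟨x, y⟩, h⟩
    simp only [Finset.mem_filter, Finset.mem_product] at h
    exact ⟨x, h.1.1, y, h.1.2, h.2⟩
  · rintro ⟨x, hx, y, hy, h⟩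
    exact ⟨(x, y), by simp [hx, hy, h]⟩

theorem iv_transposition (p : ZMod n) (A : Finset (ZMod n)) : iv (transposition p A) = iv A := by
  funext c
  have hinj : Function.Injective fun x : ZMod n => p + x := add_right_injective p
  simp only [iv, ifunc, transposition, Finset.card_filter, Finset.sum_product]
  simp only [Finset.sum_image hinj.injOn, add_sub_add_left_eq_sub]

theorem iv_inversion (p : ZMod n) (A : Finset (ZMod n)) : iv (inversion p A) = iv A := by
  funext c
  have hinj : Function.Injective fun x : ZMod n => -x + p := fun x y h => by simpa using h
  simp only [iv, ifunc, inversion, Finset.card_filter, Finset.sum_product]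
  simp only [Finset.sum_image hinj.injOn, add_sub_add_right_eq_sub, neg_sub_neg]
  exact Finset.sum_comm

theorem transposition_transposition (p q : ZMod n) (A : Finset (ZMod n)) :
    transposition p (transposition q A) = transposition (p + q) A := by
  simp only [transposition, Finset.image_image]
  congr 1
  funext x
  simp [add_assoc]

theorem transposition_inversion (p q : ZMod n) (A : Finset (ZMod n)) :
    transposition p (inversion q A) = inversion (p + q) A := by
  simp only [transposition, inversion, Finset.image_image]
  congr 1
  funext x
  simp only [Function.comp]
  ring

theorem inversion_transposition (p q : ZMod n) (A : Finset (ZMod n)) :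
    inversion p (transposition q A) = inversion (p - q) A := by
  simp only [transposition, inversion, Finset.image_image]
  congr 1
  funext x
  simp only [Function.comp]
  ring

theorem inversion_inversion (p q : ZMod n) (A : Finset (ZMod n)) :
    inversion p (inversion q A) = transposition (p - q) A := by
  simp only [transposition, inversion, Finset.image_image]
  congr 1
  funext x
  simp only [Function.comp]
  ring

theorem transposition_zero (A : Finset (ZMod n)) : transposition 0 A = A := by
  simp [transposition]

/-- `A` and `B` agree up to a transposition or an inversion. -/
def Congruent (A B : Finset (ZMod n)) : Prop :=
  ∃ p : ZMod n, transposition p A = B ∨ inversion p A = B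

theorem Congruent.symm {A B : Finset (ZMod n)} (h : Congruent A B) : Congruent B A := by
  obtain ⟨p, rfl | rfl⟩ := h
  · exact ⟨-p, .inl (by rw [transposition_transposition, neg_add_cancel, transposition_zero])⟩
  · exact ⟨p, .inr (by rw [inversion_inversion, sub_self, transposition_zero])⟩

theorem Congruent.trans {A B C : Finset (ZMod n)} (h : Congruent A B) (h' : Congruent B C) :
    Congruent A C := by
  obtain ⟨p, rfl | rfl⟩ := h <;> obtain ⟨q, rfl | rfl⟩ := h'
  · exact ⟨_, .inl (transposition_transposition ..).symm⟩
  · exact ⟨_, .inr (inversion_transposition ..).symm⟩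
  · exact ⟨_, .inr (transposition_inversion ..).symm⟩
  · exact ⟨_, .inl (inversion_inversion ..).symm⟩

theorem exists_injective_image_eq {A : Finset (ZMod n)} (hA : A.card = 4) :
    ∃ a : Fin 4 → ZMod n, Function.Injective a ∧ Finset.univ.image a = A := by
  refine ⟨fun i => ((A.equivFinOfCardEq hA).symm i).1, fun i j h => ?_, ?_⟩
  · exact (A.equivFinOfCardEq hA).symm.injective (Subtype.ext h)
  · ext x
    simp only [Finset.mem_image, Finset.mem_univ, true_and]
    constructor
    · rintro ⟨i, rfl⟩
      exact ((A.equivFinOfCardEq hA).symm i).2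
    · intro hx
      exact ⟨A.equivFinOfCardEq hA ⟨x, hx⟩, by simp⟩

theorem injective_cons_four {α : Type*} {a b c d : α}
    (hab : a ≠ b) (hac : a ≠ c) (had : a ≠ d) (hbc : b ≠ c) (hbd : b ≠ d) (hcd : c ≠ d) :
    Function.Injective ![a, b, c, d] := by
  intro i j h
  fin_cases i <;> fin_cases j <;> simp_all

theorem image_cons_four {α : Type*} [DecidableEq α] (a b c d : α) :
    Finset.univ.image ![a, b, c, d] = {a, b, c, d} := by
  ext x
  simp [Fin.exists_fin_succ, eq_comm]

theorem distinct_of_card_eq_four {α : Type*} [DecidableEq α] {a b c d : α}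
    (h : ({a, b, c, d} : Finset α).card = 4) :
    a ≠ b ∧ a ≠ c ∧ a ≠ d ∧ b ≠ c ∧ b ≠ d ∧ c ≠ d := by
  have key : ∀ x y z : α, ({a, b, c, d} : Finset α) ≠ {x, y, z} := by
    intro x y z e
    have := Finset.card_le_three (a := x) (b := y) (c := z)
    rw [← e] at this
    omega
  refine ⟨?_, ?_, ?_, ?_, ?_, ?_⟩ <;> rintro rfl
  · exact key a c d (by ext; simp)
  · exact key a b d (by ext; simp; tauto)
  · exact key a b c (by ext; simp; tauto)
  · exact key a b d (by ext; simp)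
  · exact key a b c (by ext; simp; tauto)
  · exact key a b c (by ext; simp)

theorem card_eq_four {α : Type*} [DecidableEq α] {a b c d : α}
    (hab : a ≠ b) (hac : a ≠ c) (had : a ≠ d) (hbc : b ≠ c) (hbd : b ≠ d) (hcd : c ≠ d) :
    ({a, b, c, d} : Finset α).card = 4 := by
  rw [Finset.card_eq_succ]
  exact ⟨a, {b, c, d}, by simp [*], rfl,
    Finset.card_eq_three.2 ⟨b, c, d, hbc, hbd, hcd, rfl⟩⟩

end Homometry

/-! ### Homometric quadruples with a shared triangle -/

namespace Homometry

variable {n : ℕ}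

theorem eq_of_two_mul_eq_zero [NeZero n] {u v : ZMod n} (hu : 2 * u = 0) (hv : 2 * v = 0)
    (hu0 : u ≠ 0) (hv0 : v ≠ 0) : u = v := by
  have key : ∀ x : ZMod n, 2 * x = 0 → x ≠ 0 → 2 * x.val = n := by
    intro x hx hx0
    have h1 : ((2 * x.val : ℕ) : ZMod n) = 0 := by
      push_cast
      rw [ZMod.natCast_zmod_val]
      exact hx
    obtain ⟨m, hm⟩ := (ZMod.natCast_eq_zero_iff _ _).1 h1
    have h2 : x.val < n := x.val_lt
    have h3 : x.val ≠ 0 := by rwa [Ne, ZMod.val_eq_zero]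
    have h4 : m = 1 := by
      have : m < 2 := by
        by_contra hc
        have : n * 2 ≤ n * m := Nat.mul_le_mul_left n (by omega)
        omega
      have : m ≠ 0 := by rintro rfl; omega
      omega
    rw [hm, h4, mul_one]
  apply ZMod.val_injective
  have := key u hu hu0
  have := key v hv hv0
  omega

/-- The four-element sets `{u, u + 2k, w, w + k}` with `4k = 0`. -/
def IsQuarterSet (A : Finset (ZMod n)) : Prop :=
  A.card = 4 ∧ ∃ u w k : ZMod n, 4 * k = 0 ∧ A = {u, u + 2 * k, w, w + k}

theorem inversion_four (p a b c d : ZMod n) :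
    inversion p {a, b, c, d} = {p - a, p - b, p - c, p - d} := by
  simp [inversion, Finset.image_insert, sub_eq_neg_add]

theorem transposition_four (p a b c d : ZMod n) :
    transposition p {a, b, c, d} = {p + a, p + b, p + c, p + d} := by
  simp [transposition, Finset.image_insert]

/-- The case of two quadruples sharing `p`, `q`, `r` in which the differences to `p` and `q` are
exchanged. -/
theorem quarter_or_congruent_of_swap {p q r x y : ZMod n} (hxy : x ≠ y)
    (hA : ({p, q, r, x} : Finset (ZMod n)).card = 4)
    (hp : UpToSign (x - p) (y - q)) (hq : UpToSign (x - q) (y - p))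
    (hr : UpToSign (x - r) (y - r)) :
    Congruent {p, q, r, x} {p, q, r, y} ∨ IsQuarterSet {p, q, r, x} := by
  rcases hr with hr | hr
  · exact absurd (sub_left_injective hr) hxy
  by_cases hs : x + y = p + q
  · left
    refine ⟨x + y, .inr ?_⟩
    rw [inversion_four]
    have e1 : x + y - p = q := by rw [hs]; ring
    have e2 : x + y - q = p := by rw [hs]; ring
    have e3 : x + y - r = r := by linear_combination hr
    have e4 : x + y - x = y := by ring
    rw [e1, e2, e3, e4]
    exact Finset.insert_comm ..
  · have hp' : x - p = y - q := hp.resolve_right fun h => hs (by linear_combination h)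
    have hq' : x - q = y - p := hq.resolve_right fun h => hs (by linear_combination h)
    refine .inr ⟨hA, p, r, x - r, by linear_combination 2 * hr + hp' + hq', ?_⟩
    have e1 : p + 2 * (x - r) = q := by linear_combination hr - hp' + (hp' + hq')
    rw [e1, add_sub_cancel]

/-- The case of two quadruples sharing `p`, `q`, `r` in which the differences to `p`, `q`, `r` are
permuted cyclically. -/
theorem congruent_of_cycle {p q r x y : ZMod n} (hpq : p ≠ q) (hpr : p ≠ r) (hqr : q ≠ r)
    (hp : UpToSign (x - p) (y - q)) (hq : UpToSign (x - q) (y - r))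
    (hr : UpToSign (x - r) (y - p)) :
    Congruent {p, q, r, x} {p, q, r, y} := by
  have trans : x - p = y - q → x - q = y - r → x - r = y - p →
      Congruent {p, q, r, x} {p, q, r, y} := by
    intro h1 h2 h3
    refine ⟨y - x, .inl ?_⟩
    rw [transposition_four]
    have e1 : y - x + p = q := by linear_combination -h1
    have e2 : y - x + q = r := by linear_combination -h2
    have e3 : y - x + r = p := by linear_combination -h3
    have e4 : y - x + x = y := by ring
    rw [e1, e2, e3, e4, Finset.insert_comm p q, Finset.insert_comm p r]
  have inv : ∀ a b c : ZMod n, ({a, b, c} : Finset (ZMod n)) = {p, q, r} →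
      x + y = a + b → x + y = 2 * c → Congruent {p, q, r, x} {p, q, r, y} := by
    intro a b c h h1 h2
    refine ⟨x + y, .inr ?_⟩
    have key : ∀ z : ZMod n, ({p, q, r, z} : Finset (ZMod n)) = {a, b, c, z} := by
      intro z
      simpa [Finset.insert_union] using (congrArg (· ∪ {z}) h).symm
    rw [key x, key y, inversion_four]
    have e1 : x + y - a = b := by rw [h1]; ring
    have e2 : x + y - b = a := by rw [h1]; ring
    have e3 : x + y - c = c := by rw [h2]; ring
    have e4 : x + y - x = y := by ring
    rw [e1, e2, e3, e4]
    exact Finset.insert_comm ..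
  rcases hp with hp | hp <;> rcases hq with hq | hq <;> rcases hr with hr | hr
  · exact trans hp hq hr
  · exact inv r p q (by rw [Finset.insert_comm, Finset.pair_comm r q]) (by linear_combination hr)
      (by linear_combination hr - hp + hq)
  · exact inv q r p (by rw [Finset.pair_comm r p, Finset.insert_comm]) (by linear_combination hq)
      (by linear_combination hq - hr + hp)
  · exact absurd (by linear_combination hq - hr) hpq
  · exact inv p q r rfl (by linear_combination hp)
      (by linear_combination hp - hq + hr)
  · exact absurd (by linear_combination hr - hp) hqr
  · exact absurd (by linear_combination hq - hp) hpr
  · exact absurd (by linear_combination hq - hp) hpr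

/-- Homometric quadruples sharing three points. -/
theorem quarter_or_congruent_of_three_points [NeZero n] {p q r x y : ZMod n}
    (hA : ({p, q, r, x} : Finset (ZMod n)).card = 4)
    (hB : ({p, q, r, y} : Finset (ZMod n)).card = 4)
    (h : iv {p, q, r, x} = iv {p, q, r, y}) :
    Congruent {p, q, r, x} {p, q, r, y} ∨ IsQuarterSet {p, q, r, x} := by
  by_cases hxy : x = y
  · subst hxy
    exact .inl ⟨0, .inl (transposition_zero _)⟩
  obtain ⟨hpq, hpr, hpx, hqr, hqx, hrx⟩ := distinct_of_card_eq_four hA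
  obtain ⟨-, -, hpy, -, hqy, hry⟩ := distinct_of_card_eq_four hB
  -- the differences not involving `x` or `y` cancel
  obtain ⟨σ, hσ⟩ := exists_perm_upToSign ![x - p, x - q, x - r] ![y - p, y - q, y - r] (by
    intro c
    have := congrFun h c
    rw [← image_cons_four, ← image_cons_four,
      iv_image _ (injective_cons_four hpq hpr hpx hqr hqx hrx),
      iv_image _ (injective_cons_four hpq hpr hpy hqr hqy hry)] at this
    simp only [Fin.sum_univ_succ, Fin.sum_univ_zero, Matrix.cons_val_zero, Matrix.cons_val_succ,
      sub_self, neg_sub, add_zero] at this ⊢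
    omega)
  have h0 := hσ 0
  have h1 := hσ 1
  have h2 := hσ 2
  have cases : ∀ s₀ s₁ s₂ : Fin 3, s₀ ≠ s₁ → s₀ ≠ s₂ → s₁ ≠ s₂ →
      (s₀ = 0 ∧ s₁ = 1 ∧ s₂ = 2) ∨ (s₀ = 1 ∧ s₁ = 0 ∧ s₂ = 2) ∨ (s₀ = 0 ∧ s₁ = 2 ∧ s₂ = 1) ∨
      (s₀ = 2 ∧ s₁ = 1 ∧ s₂ = 0) ∨ (s₀ = 1 ∧ s₁ = 2 ∧ s₂ = 0) ∨ (s₀ = 2 ∧ s₁ = 0 ∧ s₂ = 1) := by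
    decide
  have perm₁ : ∀ z : ZMod n, ({p, q, r, z} : Finset (ZMod n)) = {q, r, p, z} := fun z => by
    rw [Finset.insert_comm p q, Finset.insert_comm p r]
  have perm₂ : ∀ z : ZMod n, ({p, q, r, z} : Finset (ZMod n)) = {p, r, q, z} := fun z => by
    rw [Finset.insert_comm q r]
  have perm₃ : ∀ z : ZMod n, ({p, q, r, z} : Finset (ZMod n)) = {q, p, r, z} := fun z => by
    rw [Finset.insert_comm p q]
  obtain ⟨e0, e1, e2⟩ | ⟨e0, e1, e2⟩ | ⟨e0, e1, e2⟩ | ⟨e0, e1, e2⟩ | ⟨e0, e1, e2⟩ | ⟨e0, e1, e2⟩ :=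
      cases (σ 0) (σ 1) (σ 2) (by simp [σ.injective.eq_iff]) (by simp [σ.injective.eq_iff])
        (by simp [σ.injective.eq_iff]) <;>
    rw [e0] at h0 <;> rw [e1] at h1 <;> rw [e2] at h2 <;>
    simp only [Matrix.cons_val] at h0 h1 h2
  · -- reflection in `p`, `q` and `r` at once needs two elements of order `2`
    have g0 := h0.resolve_left fun e => hxy (sub_left_injective e)
    have g1 := h1.resolve_left fun e => hxy (sub_left_injective e)
    have g2 := h2.resolve_left fun e => hxy (sub_left_injective e)
    have : p - r = q - r := eq_of_two_mul_eq_zero (by linear_combination g2 - g0)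
      (by linear_combination g2 - g1) (sub_ne_zero.2 hpr) (sub_ne_zero.2 hqr)
    exact absurd (sub_left_injective this) hpq
  · exact quarter_or_congruent_of_swap hxy hA h0 h1 h2
  · rw [perm₁] at hA ⊢
    rw [perm₁ y]
    exact quarter_or_congruent_of_swap hxy hA h1 h2 h0
  · rw [perm₂] at hA ⊢
    rw [perm₂ y]
    exact quarter_or_congruent_of_swap hxy hA h0 h2 h1
  · exact .inl (congruent_of_cycle hpq hpr hqr h0 h1 h2)
  · rw [perm₃, perm₃ y]
    exact .inl (congruent_of_cycle hpq.symm hqr hpr h1 h0 h2)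

/-- Homometric quadruples containing two congruent triples. -/
theorem quarter_or_congruent_of_triangle [NeZero n] {a b : Fin 4 → ZMod n}
    (ha : Function.Injective a) (hb : Function.Injective b)
    (h : iv (Finset.univ.image a) = iv (Finset.univ.image b))
    {p q r i j k : Fin 4} (hpq : p ≠ q) (hqr : q ≠ r) (hrp : r ≠ p)
    (hij : i ≠ j) (hjk : j ≠ k) (hki : k ≠ i)
    (h1 : UpToSign (a p - a q) (b i - b j)) (h2 : UpToSign (a q - a r) (b j - b k))
    (h3 : UpToSign (a r - a p) (b k - b i)) :
    Congruent (Finset.univ.image a) (Finset.univ.image b) ∨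
      IsQuarterSet (Finset.univ.image a) := by
  have fourth : ∀ p q r : Fin 4, p ≠ q → q ≠ r → r ≠ p →
      ∃ s, (Finset.univ : Finset (Fin 4)) = {p, q, r, s} := by decide
  obtain ⟨s, hs⟩ := fourth p q r hpq hqr hrp
  obtain ⟨l, hl⟩ := fourth i j k hij hjk hki
  have hA : Finset.univ.image a = {a p, a q, a r, a s} := by rw [hs]; simp
  have hB : Finset.univ.image b = {b i, b j, b k, b l} := by rw [hl]; simp
  have cA : (Finset.univ.image a).card = 4 := by simp [Finset.card_image_of_injective _ ha]
  have cB : (Finset.univ.image b).card = 4 := by simp [Finset.card_image_of_injective _ hb]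
  -- it suffices to move `b i`, `b j`, `b k` onto `a p`, `a q`, `a r`
  have finish : ∀ (C : Finset (ZMod n)) (y : ZMod n), Congruent (Finset.univ.image b) C →
      iv C = iv (Finset.univ.image b) → C.card = 4 → C = {a p, a q, a r, y} →
      Congruent (Finset.univ.image a) (Finset.univ.image b) ∨
        IsQuarterSet (Finset.univ.image a) := by
    rintro C y hC hiv hcard rfl
    rw [hA] at cA h ⊢
    rcases quarter_or_congruent_of_three_points cA hcard (h.trans hiv.symm) with h' | h'
    · exact .inl (h'.trans hC.symm)
    · exact .inr h'
  have direct : a p - a q = b i - b j → a r - a p = b k - b i →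
      Congruent (Finset.univ.image a) (Finset.univ.image b) ∨
        IsQuarterSet (Finset.univ.image a) := by
    intro e1 e2
    refine finish (transposition (a p - b i) (Finset.univ.image b)) (a p - b i + b l)
      ⟨_, .inl rfl⟩ (iv_transposition _ _) ?_ ?_
    · rw [transposition, Finset.card_image_of_injective _ (add_right_injective _), cB]
    · rw [hB, transposition_four]
      congr 1
      · ring
      congr 1
      · linear_combination e1
      congr 1
      linear_combination -e2
  have opposite : a p - a q = -(b i - b j) → a r - a p = -(b k - b i) →
      Congruent (Finset.univ.image a) (Finset.univ.image b) ∨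
        IsQuarterSet (Finset.univ.image a) := by
    intro e1 e2
    refine finish (inversion (a p + b i) (Finset.univ.image b)) (a p + b i - b l)
      ⟨_, .inr rfl⟩ (iv_inversion _ _) ?_ ?_
    · rw [inversion, Finset.card_image_of_injective _ fun x y h => by simpa using h, cB]
    · rw [hB, inversion_four]
      congr 1
      · ring
      congr 1
      · linear_combination e1
      congr 1
      linear_combination -e2
  -- two equal signs among three force the third
  rcases h1 with h1 | h1 <;> rcases h2 with h2 | h2 <;> rcases h3 with h3 | h3
  · exact direct h1 h3
  · exact direct h1 (by linear_combination -h1 - h2)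
  · exact direct h1 h3
  · exact opposite (by linear_combination -h2 - h3) h3
  · exact direct (by linear_combination -h2 - h3) h3
  · exact opposite h1 h3
  · exact opposite h1 (by linear_combination -h1 - h2)
  · exact opposite h1 h3

end Homometry

/-! ### Homometric quadruples without a shared triangle -/

namespace Homometry

variable {n : ℕ}

theorem UpToSign.refl (x : ZMod n) : UpToSign x x := .inl rfl

theorem UpToSign.symm {x y : ZMod n} (h : UpToSign x y) : UpToSign y x := by
  rcases h with rfl | rfl
  · exact .inl rfl
  · exact .inr (neg_neg y).symm

theorem UpToSign.trans {x y z : ZMod n} (h : UpToSign x y) (h' : UpToSign y z) :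
    UpToSign x z := by
  rcases h with rfl | rfl
  · exact h'
  · rcases h' with rfl | rfl
    · exact .inr rfl
    · exact .inl (neg_neg z)

/-- Three of the points `a i` have differences `x`, `y`, `z` up to signs. -/
def HasTriangle (a : Fin 4 → ZMod n) (x y z : ZMod n) : Prop :=
  ∃ p q r : Fin 4, p ≠ q ∧ q ≠ r ∧ r ≠ p ∧
    UpToSign (a p - a q) x ∧ UpToSign (a q - a r) y ∧ UpToSign (a r - a p) z

theorem HasTriangle.congr {a : Fin 4 → ZMod n} {x y z x' y' z' : ZMod n}
    (h : HasTriangle a x y z) (hx : UpToSign x x') (hy : UpToSign y y') (hz : UpToSign z z') :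
    HasTriangle a x' y' z' := by
  obtain ⟨p, q, r, hpq, hqr, hrp, h1, h2, h3⟩ := h
  exact ⟨p, q, r, hpq, hqr, hrp, h1.trans hx, h2.trans hy, h3.trans hz⟩

theorem HasTriangle.rotate {a : Fin 4 → ZMod n} {x y z : ZMod n} (h : HasTriangle a x y z) :
    HasTriangle a y z x := by
  obtain ⟨p, q, r, hpq, hqr, hrp, h1, h2, h3⟩ := h
  exact ⟨q, r, p, hqr, hrp, hpq, h2, h3, h1⟩

theorem HasTriangle.swap {a : Fin 4 → ZMod n} {x y z : ZMod n} (h : HasTriangle a x y z) :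
    HasTriangle a y x z := by
  obtain ⟨p, q, r, hpq, hqr, hrp, h1, h2, h3⟩ := h
  refine ⟨r, q, p, hqr.symm, hpq.symm, hrp.symm, ?_, ?_, ?_⟩
  · exact .trans (.inr (neg_sub _ _).symm) h2
  · exact .trans (.inr (neg_sub _ _).symm) h1
  · exact .trans (.inr (neg_sub _ _).symm) h3

/-- The sides of a triangle add up to zero for some choice of signs, here up to a global sign. -/
theorem HasTriangle.signed_sum {a : Fin 4 → ZMod n} {x y z : ZMod n} (h : HasTriangle a x y z) :
    x + y + z = 0 ∨ x = y + z ∨ y = x + z ∨ z = x + y := by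
  obtain ⟨p, q, r, -, -, -, h1, h2, h3⟩ := h
  rcases h1 with h1 | h1 <;> rcases h2 with h2 | h2 <;> rcases h3 with h3 | h3
  · exact .inl (by linear_combination -h1 - h2 - h3)
  · exact .inr (.inr (.inr (by linear_combination h1 + h2 + h3)))
  · exact .inr (.inr (.inl (by linear_combination h1 + h2 + h3)))
  · exact .inr (.inl (by linear_combination -h1 - h2 - h3))
  · exact .inr (.inl (by linear_combination h1 + h2 + h3))
  · exact .inr (.inr (.inl (by linear_combination -h1 - h2 - h3)))
  · exact .inr (.inr (.inr (by linear_combination -h1 - h2 - h3)))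
  · exact .inl (by linear_combination h1 + h2 + h3)

/-- Some triangle among the points `a i` is congruent to one among the points `b i`. -/
def ShareTriangle (a b : Fin 4 → ZMod n) : Prop :=
  ∃ i j k : Fin 4, i ≠ j ∧ j ≠ k ∧ k ≠ i ∧ HasTriangle a (b i - b j) (b j - b k) (b k - b i)

/-- If the differences along a path of `b` are the sides of a triangle of `a`, then, unless a
triangle is shared, it is the middle difference whose sign has to be changed: changing the sign of
an end difference makes it equal to the third side of a triangle of `b`. -/
theorem eq_two_mul_of_path {a b : Fin 4 → ZMod n} (hb : Function.Injective b)
    (hs : ¬ ShareTriangle a b) {i j k l : Fin 4} (hij : i ≠ j) (hik : i ≠ k) (hil : i ≠ l)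
    (hjk : j ≠ k) (hjl : j ≠ l) (hkl : k ≠ l)
    (h : HasTriangle a (b i - b j) (b j - b k) (b k - b l)) :
    b l - b i = 2 * (b k - b j) := by
  rcases h.signed_sum with e | e | e | e
  · exact absurd (hb (by linear_combination e)) hil
  · refine absurd ⟨j, k, l, hjk, hkl, hjl.symm, ?_⟩ hs
    exact (h.congr (.inr (by linear_combination e)) (.refl _) (.refl _)).rotate
  · linear_combination e
  · refine absurd ⟨i, j, k, hij, hjk, hik.symm, ?_⟩ hs
    exact h.congr (.refl _) (.refl _) (.inr (by linear_combination e))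

/-- If the differences along a star of `b` are the sides of a triangle of `a`, then, unless a
triangle is shared, the centre of the star is the barycentre, and no two pairs of points of `b` have
the same sum: such a coincidence makes a side of the star equal to a side that closes a
triangle. -/
theorem barycentre_of_star {a b : Fin 4 → ZMod n} (hs : ¬ ShareTriangle a b) {i j k l : Fin 4}
    (hij : i ≠ j) (hik : i ≠ k) (hil : i ≠ l) (hjk : j ≠ k) (hjl : j ≠ l)
    (h : HasTriangle a (b i - b j) (b i - b k) (b i - b l)) :
    4 * b i = b i + b j + b k + b l ∧ b i + b j ≠ b k + b l ∧ b i + b k ≠ b j + b l ∧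
      b i + b l ≠ b j + b k := by
  have h1 : b i + b j ≠ b k + b l := by
    intro e
    refine hs ⟨i, j, l, hij, hjl, hil.symm, ?_⟩
    exact h.congr (.refl _) (.inr (by linear_combination e)) (.inr (by ring))
  have h2 : b i + b k ≠ b j + b l := by
    intro e
    refine hs ⟨i, j, k, hij, hjk, hik.symm, ?_⟩
    exact h.swap.rotate.congr (.refl _) (.inl (by linear_combination e)) (.inr (by ring))
  have h3 : b i + b l ≠ b j + b k := by
    intro e
    refine hs ⟨i, j, l, hij, hjl, hil.symm, ?_⟩
    exact h.congr (.refl _) (.inl (by linear_combination e)) (.inr (by ring))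
  refine ⟨?_, h1, h2, h3⟩
  rcases h.signed_sum with e | e | e | e
  · linear_combination e
  · exact absurd (by linear_combination -e) h1
  · exact absurd (by linear_combination -e) h2
  · exact absurd (by linear_combination -e) h3

/-- The difference along an edge. -/
def edgeDiff (a : Fin 4 → ZMod n) : Fin 6 → ZMod n :=
  ![a 1 - a 0, a 2 - a 0, a 3 - a 0, a 2 - a 1, a 3 - a 1, a 3 - a 2]

theorem upToSign_edgeDiff (a : Fin 4 → ZMod n) {i j : Fin 4} (h : i ≠ j) :
    UpToSign (a i - a j) (edgeDiff a (edge i j)) := by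
  fin_cases i <;> fin_cases j <;>
    first
    | exact absurd rfl h
    | exact .inl rfl
    | exact .inr (neg_sub _ _).symm

theorem exists_perm_edgeDiff {a b : Fin 4 → ZMod n} (ha : Function.Injective a)
    (hb : Function.Injective b) (h : iv (Finset.univ.image a) = iv (Finset.univ.image b)) :
    ∃ τ : Equiv.Perm (Fin 6), ∀ e, UpToSign (edgeDiff b e) (edgeDiff a (τ e)) := by
  refine exists_perm_upToSign _ _ fun c => ?_
  have := congrFun h c
  rw [iv_image _ ha, iv_image _ hb] at this
  simp only [edgeDiff, Fin.sum_univ_succ, Fin.sum_univ_zero, Matrix.cons_val_zero,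
    Matrix.cons_val_succ, sub_self, neg_sub, add_zero, Fin.succ_zero_eq_one,
    Fin.succ_one_eq_two, (by decide : Fin.succ (2 : Fin 3) = 3)] at this ⊢
  omega

theorem hasTriangle_of_isTriangle {a b : Fin 4 → ZMod n} {τ : Fin 6 → Fin 6}
    (hτ : ∀ e, UpToSign (edgeDiff b e) (edgeDiff a (τ e))) {i j k l i' j' : Fin 4}
    (hij : i ≠ j) (hkl : k ≠ l) (hij' : i' ≠ j')
    (h : IsTriangle (τ (edge i j)) (τ (edge k l)) (τ (edge i' j'))) :
    HasTriangle a (b i - b j) (b k - b l) (b i' - b j') := by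
  obtain ⟨p, q, r, hpq, hqr, hrp, h1, h2, h3⟩ := h
  have key : ∀ {s t u v : Fin 4}, s ≠ t → u ≠ v → τ (edge s t) = edge u v →
      UpToSign (a u - a v) (b s - b t) := by
    intro s t u v hst huv e
    exact (upToSign_edgeDiff a huv).trans
      (.trans (e ▸ (hτ (edge s t)).symm) (upToSign_edgeDiff b hst).symm)
  exact ⟨p, q, r, hpq, hqr, hrp, key hij hpq h1, key hkl hqr h2, key hij' hrp h3⟩

/-- Three distinct nonzero solutions of `4x = 0`: one of them is the sum of the two others. -/
theorem add_eq_of_four_mul_eq_zero [NeZero n] {x y z : ZMod n} (hx : 4 * x = 0) (hy : 4 * y = 0)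
    (hz : 4 * z = 0) (hx0 : x ≠ 0) (hy0 : y ≠ 0) (hz0 : z ≠ 0) (hxy : x ≠ y) (hxz : x ≠ z)
    (hyz : y ≠ z) : x = y + z ∨ y = x + z ∨ z = x + y := by
  have dbl : ∀ {u v : ZMod n}, 4 * u = 0 → 4 * v = 0 → 2 * u ≠ 0 → 2 * v ≠ 0 → 2 * u = 2 * v :=
    fun hu hv => eq_of_two_mul_eq_zero (by linear_combination hu) (by linear_combination hv)
  by_cases h1 : 2 * x = 0
  · have h2 : 2 * y ≠ 0 := fun h => hxy (eq_of_two_mul_eq_zero h1 h hx0 hy0)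
    have h3 : 2 * z ≠ 0 := fun h => hxz (eq_of_two_mul_eq_zero h1 h hx0 hz0)
    have h4 := dbl hy hz h2 h3
    have : x = y - z := eq_of_two_mul_eq_zero h1 (by linear_combination h4) hx0 (sub_ne_zero.2 hyz)
    exact .inr (.inl (by rw [this]; ring))
  · by_cases h2 : 2 * y = 0
    · have h3 : 2 * z ≠ 0 := fun h => hyz (eq_of_two_mul_eq_zero h2 h hy0 hz0)
      have h4 := dbl hx hz h1 h3
      have : y = x - z :=
        eq_of_two_mul_eq_zero h2 (by linear_combination h4) hy0 (sub_ne_zero.2 hxz)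
      exact .inl (by rw [this]; ring)
    · have h4 := dbl hx hy h1 h2
      have h5 : 2 * (x - y) = 0 := by linear_combination h4
      by_cases h3 : 2 * z = 0
      · have : z = x - y := eq_of_two_mul_eq_zero h3 h5 hz0 (sub_ne_zero.2 hxy)
        exact .inl (by rw [this]; ring)
      · have h6 := dbl hx hz h1 h3
        have : x - y = x - z := eq_of_two_mul_eq_zero h5 (by linear_combination h6)
          (sub_ne_zero.2 hxy) (sub_ne_zero.2 hxz)
        exact absurd (sub_right_injective this) hyz

/-- Homometric quadruples without a shared triangle: the differences of matching edges force
`b` into a coset of the subgroup of order `13`, or into quarter form. -/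
theorem thirteen_or_quarter_of_not_shareTriangle [NeZero n] {a b : Fin 4 → ZMod n}
    (ha : Function.Injective a) (hb : Function.Injective b)
    (h : iv (Finset.univ.image a) = iv (Finset.univ.image b)) (hs : ¬ ShareTriangle a b) :
    (∀ i j, 13 * (b i - b j) = 0) ∨ IsQuarterSet (Finset.univ.image b) := by
  obtain ⟨τ, hτ⟩ := exists_perm_edgeDiff ha hb h
  have tri := @hasTriangle_of_isTriangle n a b τ hτ
  have star : ∀ {i j k l : Fin 4}, i ≠ j → i ≠ k → i ≠ l → j ≠ k → j ≠ l →
      IsTriangle (τ (edge i j)) (τ (edge i k)) (τ (edge i l)) → _ :=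
    fun hij hik hil hjk hjl H =>
      barycentre_of_star hs hij hik hil hjk hjl (tri hij hik hil H)
  have path : ∀ {i j k l : Fin 4}, i ≠ j → i ≠ k → i ≠ l → j ≠ k → j ≠ l → k ≠ l →
      IsTriangle (τ (edge i j)) (τ (edge j k)) (τ (edge k l)) → b l - b i = 2 * (b k - b j) :=
    fun hij hik hil hjk hjl hkl H =>
      eq_two_mul_of_path hb hs hij hik hil hjk hjl hkl (tri hij hjk hkl H)
  rcases trianglePattern_perm τ with ⟨i, j, hij, k, hjk, H⟩ | ⟨H0, H1, H2, H3⟩ |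
    ⟨i, j, hij, k, hik, hjk, l, hil, hjl, hkl, H2, H3 | ⟨H1, H3⟩⟩
  · have hki := (hij.trans hjk).ne'
    exact absurd ⟨i, j, k, hij.ne, hjk.ne, hki, tri hij.ne hjk.ne hki H⟩ hs
  · -- every point is the barycentre, so the points form a coset of the subgroup of order `4`
    obtain ⟨e0, n1, n2, n3⟩ := star (by decide) (by decide) (by decide) (by decide) (by decide) H0
    obtain ⟨e1, -⟩ := star (by decide) (by decide) (by decide) (by decide) (by decide) H1
    obtain ⟨e2, -⟩ := star (by decide) (by decide) (by decide) (by decide) (by decide) H2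
    obtain ⟨e3, -⟩ := star (by decide) (by decide) (by decide) (by decide) (by decide) H3
    have ne : ∀ {i j : Fin 4}, i ≠ j → b i ≠ b j := fun h e => h (hb e)
    rcases add_eq_of_four_mul_eq_zero (x := b 1 - b 0) (y := b 2 - b 0) (z := b 3 - b 0)
      (by linear_combination e1 - e0) (by linear_combination e2 - e0)
      (by linear_combination e3 - e0) (sub_ne_zero.2 (ne (by decide)))
      (sub_ne_zero.2 (ne (by decide))) (sub_ne_zero.2 (ne (by decide)))
      (fun e => ne (by decide) (sub_left_injective e))
      (fun e => ne (by decide) (sub_left_injective e))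
      (fun e => ne (by decide) (sub_left_injective e)) with e | e | e
    · exact absurd (by linear_combination e) n1
    · exact absurd (by linear_combination e) n2
    · exact absurd (by linear_combination e) n3
  · have p1 := path hik hil hij hkl hjk.symm hjl.symm H2
    have p2 := path hil hik hij hkl.symm hjl.symm hjk.symm H3
    have univ_eq : ∀ i j k l : Fin 4, i ≠ j → i ≠ k → i ≠ l → j ≠ k → j ≠ l → k ≠ l →
        (Finset.univ : Finset (Fin 4)) = {i, j, k, l} := by decide
    refine .inr ⟨by simp [Finset.card_image_of_injective _ hb], b i, b k, b l - b k,
      by linear_combination p2 - p1, ?_⟩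
    rw [univ_eq i j k l hij hik hil hjk hjl hkl]
    have e1 : b i + 2 * (b l - b k) = b j := by linear_combination -p1
    rw [e1, add_sub_cancel]
    simp
  · -- with `b i = 0`, the equations give `b k = -4 (b j)`, `b l = 3 (b j)`, `13 (b j) = 0`
    have p1 := path hij hik hil hjk hjl hkl H1
    have p2 := path hik hil hij hkl hjk.symm hjl.symm H2
    have p3 := path hil hij hik hjl.symm hkl.symm hjk H3
    have hl : b l - b i = 3 * (b j - b i) := by linear_combination -p1 - p2
    have hk : b k - b i = -4 * (b j - b i) := by linear_combination p3 - 2 * hl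
    have hj : 13 * (b j - b i) = 0 := by linear_combination p1 - hl + 2 * hk
    have all : ∀ i j k l : Fin 4, i ≠ j → i ≠ k → i ≠ l → j ≠ k → j ≠ l → k ≠ l →
        ∀ s, s = i ∨ s = j ∨ s = k ∨ s = l := by decide
    have key : ∀ s, 13 * (b s - b i) = 0 := by
      intro s
      rcases all i j k l hij hik hil hjk hjl hkl s with rfl | rfl | rfl | rfl
      · ring
      · exact hj
      · linear_combination 13 * hk - 4 * hj
      · linear_combination 13 * hl + 3 * hj
    exact .inl fun s t => by linear_combination key s - key t

end Homometry

/-! ### Quarter sets and lifts to the dihedral group -/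

namespace Homometry

variable {n : ℕ}

/-- The elements `x` and `y` lie in the same coset of the multiples of `k`. The multiples are
listed for `4k = 0`, the only case in which this is used. -/
def SameCoset (k x y : ZMod n) : Prop := y = x ∨ y = x + k ∨ y = x + 2 * k ∨ y = x + 3 * k

/-- In a set `{u, u + 2k, w, w + k}` of four elements the points `u` and `w` lie in different cosets
of the multiples of `k`. -/
theorem not_sameCoset_of_card {u w k : ZMod n} (hk : 4 * k = 0)
    (h : ({u, u + 2 * k, w, w + k} : Finset (ZMod n)).card = 4) :
    2 * k ≠ 0 ∧ ¬ SameCoset k u w := by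
  obtain ⟨h1, h2, h3, h4, h5, -⟩ := distinct_of_card_eq_four h
  refine ⟨fun e => h1 (by rw [e, add_zero]), ?_⟩
  rintro (e | e | e | e)
  · exact h2 e.symm
  · exact h5 (by linear_combination -e)
  · exact h4 e.symm
  · exact h3 (by linear_combination -e - hk)

theorem eq_of_sub_eq_quarter {u w k x y : ZMod n} (hk : 4 * k = 0) (hk2 : 2 * k ≠ 0)
    (hc : ¬ SameCoset k u w) (hx : x ∈ ({u, u + 2 * k, w, w + k} : Finset (ZMod n)))
    (hy : y ∈ ({u, u + 2 * k, w, w + k} : Finset (ZMod n))) (h : y - x = k) : x = w := by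
  simp only [SameCoset, Finset.mem_insert, Finset.mem_singleton] at hc hx hy
  rcases hx with rfl | rfl | rfl | rfl <;> rcases hy with rfl | rfl | rfl | rfl <;> grind

theorem sub_mem_cosets {u w k x y : ZMod n} (hk : 4 * k = 0)
    (hx : x ∈ ({u, u + 2 * k, w, w + k} : Finset (ZMod n)))
    (hy : y ∈ ({u, u + 2 * k, w, w + k} : Finset (ZMod n))) :
    SameCoset k x y ∨ SameCoset k (w - u) (y - x) ∨ SameCoset k (w - u) (x - y) := by
  simp only [SameCoset, Finset.mem_insert, Finset.mem_singleton] at hx hy ⊢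
  rcases hx with rfl | rfl | rfl | rfl <;> rcases hy with rfl | rfl | rfl | rfl <;> grind

/-- A quadruple homometric to a quarter set has the same form, with the same `k` and, up to sign,
the same difference of cosets. -/
theorem exists_quarter_form {A : Finset (ZMod n)} {u w k : ZMod n} (hk : 4 * k = 0)
    (hB : ({u, u + 2 * k, w, w + k} : Finset (ZMod n)).card = 4) (hA : A.card = 4)
    (h : iv A = iv {u, u + 2 * k, w, w + k}) :
    ∃ p q : ZMod n, A = {p, p + 2 * k, q, q + k} ∧
      (SameCoset k (w - u) (q - p) ∨ SameCoset k (w - u) (p - q)) := by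
  obtain ⟨hk2, hc⟩ := not_sameCoset_of_card hk hB
  have diff : ∀ c, (∃ x ∈ A, ∃ y ∈ A, y - x = c) ↔ ∃ x ∈ ({u, u + 2 * k, w, w + k} :
      Finset (ZMod n)), ∃ y ∈ ({u, u + 2 * k, w, w + k} : Finset (ZMod n)), y - x = c := by
    intro c
    rw [← iv_pos_iff, ← iv_pos_iff, h]
  obtain ⟨p, hp, p', hp', ep⟩ := (diff (2 * k)).2 ⟨u, by simp, u + 2 * k, by simp, by ring⟩
  obtain ⟨q, hq, q', hq', eq⟩ := (diff k).2 ⟨w, by simp, w + k, by simp, by ring⟩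
  obtain rfl : p' = p + 2 * k := by linear_combination ep
  obtain rfl : q' = q + k := by linear_combination eq
  have hk0 : k ≠ 0 := by rintro rfl; simp at hk2
  -- the difference `k` occurs only once
  have no_three : ∀ t, t ∈ A → t + k ∈ A → t + 2 * k ∈ A → False := by
    intro t h0 h1 h2
    have le : iv {u, u + 2 * k, w, w + k} k ≤ 1 := by
      rw [iv, ifunc, Finset.card_le_one]
      rintro ⟨x, y⟩ hxy ⟨x', y'⟩ hxy'
      simp only [Finset.mem_filter, Finset.mem_product] at hxy hxy'
      have e1 := eq_of_sub_eq_quarter hk hk2 hc hxy.1.1 hxy.1.2 hxy.2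
      have e2 := eq_of_sub_eq_quarter hk hk2 hc hxy'.1.1 hxy'.1.2 hxy'.2
      have e3 := hxy.2
      have e4 := hxy'.2
      rw [Prod.mk.injEq]
      exact ⟨e1.trans e2.symm, by linear_combination e3 - e4 + e1 - e2⟩
    rw [← h, iv, ifunc, Finset.card_le_one] at le
    have := le (t, t + k) (by simp [h0, h1]) (t + k, t + 2 * k) (by simp [h1, h2]; ring)
    rw [Prod.mk.injEq] at this
    exact hk0 (by linear_combination -this.1)
  have n1 : q ≠ p := by
    rintro rfl
    exact no_three q hp hq' hp'
  have n2 : q ≠ p + 2 * k := by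
    rintro rfl
    refine no_three (p + 2 * k) hp' hq' ?_
    convert hp using 1
    linear_combination hk
  have n3 : q + k ≠ p := by
    rintro rfl
    refine no_three (q + k + 2 * k) hp' ?_ ?_
    · convert hq using 1
      linear_combination hk
    · convert hq' using 1
      linear_combination hk
  have n4 : q + k ≠ p + 2 * k := by
    intro e
    refine no_three p hp ?_ hp'
    convert hq using 1
    linear_combination -e
  have hpq : ({p, p + 2 * k, q, q + k} : Finset (ZMod n)).card = 4 :=
    card_eq_four (fun e => hk2 (by linear_combination -e)) n1.symm n3.symm n2.symm n4.symm
      (fun e => hk0 (by linear_combination -e))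
  refine ⟨p, q, (Finset.eq_of_subset_of_card_le ?_ (by rw [hA, hpq])).symm, ?_⟩
  · simp [Finset.insert_subset_iff, hp, hp', hq, hq']
  · obtain ⟨x, hx, y, hy, e⟩ := (diff (q - p)).1 ⟨p, hp, q, hq, rfl⟩
    have e' : p - q = x - y := by linear_combination e
    rw [← e, e']
    refine (sub_mem_cosets hk hx hy).resolve_left fun H => ?_
    refine (not_sameCoset_of_card hk hpq).2 ?_
    have : q - p + x = y := by rw [← e]; ring
    rcases H with H | H | H | H
    · exact .inl (by linear_combination this + H)
    · exact .inr (.inl (by linear_combination this + H))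
    · exact .inr (.inr (.inl (by linear_combination this + H)))
    · exact .inr (.inr (.inr (by linear_combination this + H)))

namespace Dih

theorem mul_proj (x y : Dih n) : (x * y).proj = x.proj + act x.sign y.proj := rfl

/-- Left translations of the dihedral group project to transpositions and inversions. -/
theorem congruent_of_left_translate {S T : Finset (Dih n)} {g : Dih n}
    (h : S.image (fun x => g * x) = T) : Congruent (S.image proj) (T.image proj) := by
  subst h
  refine ⟨g.proj, ?_⟩
  rcases Int.units_eq_one_or g.sign with hg | hg
  · left
    rw [transposition, Finset.image_image, Finset.image_image]
    congr 1
    funext x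
    simp [mul_proj, hg, act_one]
  · right
    rw [inversion, Finset.image_image, Finset.image_image]
    congr 1
    funext x
    simp only [Function.comp, mul_proj, hg, act_neg_one]
    ring

theorem nontriviallyRightHomometric_of_proj {S T : Finset (Dih n)} (h : rightIv S = rightIv T)
    (hST : NontriviallyHomometric (S.image proj) (T.image proj)) :
    NontriviallyRightHomometric S T :=
  ⟨h, fun ⟨_, hg⟩ => hST.2 (congruent_of_left_translate hg)⟩

/-- The lift of a set with all signs equal to `1`. -/
def positiveLift (A : Finset (ZMod n)) : Finset (Dih n) := A.image fun k => ⟨k, 1⟩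

theorem image_proj_positiveLift (A : Finset (ZMod n)) : (positiveLift A).image proj = A := by
  rw [positiveLift, Finset.image_image]
  exact Finset.image_id

theorem injective_mk (ε : ℤˣ) : Function.Injective fun k : ZMod n => (⟨k, ε⟩ : Dih n) :=
  fun _ _ h => congrArg proj h

theorem card_positiveLift (A : Finset (ZMod n)) : (positiveLift A).card = A.card :=
  Finset.card_image_of_injective _ (injective_mk 1)

theorem rightIv_positiveLift (A : Finset (ZMod n)) (g : Dih n) :
    rightIv (positiveLift A) g = if g.sign = 1 then iv A g.proj else 0 := by
  obtain ⟨c, ε⟩ := g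
  rw [rightIv, positiveLift, Finset.card_filter, Finset.sum_product,
    Finset.sum_image (injective_mk 1).injOn]
  simp only [Finset.sum_image (injective_mk 1).injOn, rightInt, inv_one, act_one, div_one,
    Dih.mk.injEq]
  by_cases hε : ε = 1
  · rw [iv, ifunc, Finset.card_filter, Finset.sum_product]
    simp [hε]
  · simp [hε, Ne.symm hε]

theorem rightIv_image {ι : Type*} [Fintype ι] (s : ι → Dih n) (hs : Function.Injective s)
    (c : ZMod n) (η : ℤˣ) :
    rightIv (Finset.univ.image s) ⟨c, η⟩ = ∑ i, ∑ j,
      if (s j).sign / (s i).sign = η then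
        hit (act (s i).sign⁻¹ ((s j).proj - (s i).proj)) c else 0 := by
  rw [rightIv, Finset.card_filter, Finset.sum_product, Finset.sum_image fun x _ y _ h => hs h]
  refine Finset.sum_congr rfl fun i _ => ?_
  rw [Finset.sum_image fun x _ y _ h => hs h]
  refine Finset.sum_congr rfl fun j _ => ?_
  simp only [rightInt, Dih.mk.injEq, hit, ite_and]
  split_ifs <;> rfl

/-- The lift of `{u, u + 2k, w, w + k}` giving the sign `ε` to the first two elements and the
sign `-ε` to the others. -/
def quarterLift (ε : ℤˣ) (u w k : ZMod n) : Finset (Dih n) :=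
  {⟨u, ε⟩, ⟨u + 2 * k, ε⟩, ⟨w, -ε⟩, ⟨w + k, -ε⟩}

theorem image_proj_quarterLift (ε : ℤˣ) (u w k : ZMod n) :
    (quarterLift ε u w k).image proj = {u, u + 2 * k, w, w + k} := by
  simp [quarterLift, Finset.image_insert]

theorem card_quarterLift (ε : ℤˣ) {u w k : ZMod n}
    (h : ({u, u + 2 * k, w, w + k} : Finset (ZMod n)).card = 4) :
    (quarterLift ε u w k).card = 4 := by
  refine le_antisymm Finset.card_le_four ?_
  rw [← h, ← image_proj_quarterLift ε]
  exact Finset.card_image_le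

theorem card_signPart_quarterLift (ε η : ℤˣ) {u w k : ZMod n}
    (h : ({u, u + 2 * k, w, w + k} : Finset (ZMod n)).card = 4) :
    (signPart η (quarterLift ε u w k)).card = 2 := by
  obtain ⟨h1, -, -, -, -, h2⟩ := distinct_of_card_eq_four h
  have hε : -ε ≠ ε := by rcases Int.units_eq_one_or ε with rfl | rfl <;> decide
  have hη : η = ε ∨ η = -ε := by
    rcases Int.units_eq_one_or ε with rfl | rfl <;> rcases Int.units_eq_one_or η with rfl | rfl <;>
      decide
  rw [signPart, quarterLift, Finset.card_eq_two]
  rcases hη with rfl | rfl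
  · refine ⟨⟨u, η⟩, ⟨u + 2 * k, η⟩, fun e => h1 (congrArg proj e), ?_⟩
    simp [Finset.filter_insert, Finset.filter_singleton, hε]
  · refine ⟨⟨w, -ε⟩, ⟨w + k, -ε⟩, fun e => h2 (congrArg proj e), ?_⟩
    simp [Finset.filter_insert, Finset.filter_singleton, hε.symm]

/-- The intervals between elements of equal signs depend only on `k`. -/
theorem rightIv_quarterLift_one (ε : ℤˣ) {u w k : ZMod n} (hk : 4 * k = 0)
    (h : ({u, u + 2 * k, w, w + k} : Finset (ZMod n)).card = 4) (c : ZMod n) :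
    rightIv (quarterLift ε u w k) ⟨c, 1⟩ =
      4 * hit 0 c + 2 * hit (2 * k) c + hit k c + hit (-k) c := by
  have hne := distinct_of_card_eq_four (card_quarterLift ε h)
  have m2 : -(2 * k) = 2 * k := by linear_combination -hk
  rw [quarterLift, ← image_cons_four, rightIv_image _
    (injective_cons_four hne.1 hne.2.1 hne.2.2.1 hne.2.2.2.1 hne.2.2.2.2.1 hne.2.2.2.2.2)]
  rcases Int.units_eq_one_or ε with rfl | rfl
  · simp [Fin.sum_univ_succ, act_one, act_neg_one, m2]
    omega
  · simp [Fin.sum_univ_succ, act_one, act_neg_one, m2]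
    omega

/-- The intervals between elements of opposite signs run twice through a coset of the multiples
of `k`. -/
theorem rightIv_quarterLift_neg_one (ε : ℤˣ) {u w k : ZMod n} (hk : 4 * k = 0)
    (h : ({u, u + 2 * k, w, w + k} : Finset (ZMod n)).card = 4) (c : ZMod n) :
    rightIv (quarterLift ε u w k) ⟨c, -1⟩ =
      2 * (hit (act ε (w - u)) c + hit (act ε (w - u) + k) c + hit (act ε (w - u) + 2 * k) c +
        hit (act ε (w - u) + 3 * k) c) := by
  have hne := distinct_of_card_eq_four (card_quarterLift ε h)
  rw [quarterLift, ← image_cons_four, rightIv_image _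
    (injective_cons_four hne.1 hne.2.1 hne.2.2.1 hne.2.2.2.1 hne.2.2.2.2.1 hne.2.2.2.2.2)]
  have e1 : w - (u + 2 * k) = w - u + 2 * k := by linear_combination -hk
  have e2 : w + k - u = w - u + k := by ring
  have e3 : w + k - (u + 2 * k) = w - u + 3 * k := by linear_combination -hk
  have e4 : u + 2 * k - w = u - w + 2 * k := by ring
  have e5 : u - (w + k) = u - w + 3 * k := by linear_combination -hk
  have e6 : u + 2 * k - (w + k) = u - w + k := by ring
  rcases Int.units_eq_one_or ε with rfl | rfl
  · simp [Fin.sum_univ_succ, act_one, act_neg_one, e1, e2, e3]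
    omega
  · simp [Fin.sum_univ_succ, act_one, act_neg_one, e4, e5, e6]
    omega

end Dih

end Homometry

/-! ### Existence of the lifts -/

namespace Homometry

variable {n : ℕ}

theorem hit_sum_of_sameCoset {k x y : ZMod n} (hk : 4 * k = 0) (h : SameCoset k x y) (c : ZMod n) :
    hit y c + hit (y + k) c + hit (y + 2 * k) c + hit (y + 3 * k) c =
      hit x c + hit (x + k) c + hit (x + 2 * k) c + hit (x + 3 * k) c := by
  have e1 : x + k + k = x + 2 * k := by ring
  have e2 : x + k + 2 * k = x + 3 * k := by ring
  have e3 : x + k + 3 * k = x := by linear_combination hk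
  have e4 : x + 2 * k + k = x + 3 * k := by ring
  have e5 : x + 2 * k + 2 * k = x := by linear_combination hk
  have e6 : x + 2 * k + 3 * k = x + k := by linear_combination hk
  have e7 : x + 3 * k + k = x := by linear_combination hk
  have e8 : x + 3 * k + 2 * k = x + k := by linear_combination hk
  have e9 : x + 3 * k + 3 * k = x + 2 * k := by linear_combination hk
  rcases h with rfl | rfl | rfl | rfl
  · rfl
  · rw [e1, e2, e3]
    ring
  · rw [e4, e5, e6]
    ring
  · rw [e7, e8, e9]
    ring

namespace Dih

/-- A lift of a set of four elements using each sign twice. -/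
def IsBalancedLift (S : Finset (Dih n)) (A : Finset (ZMod n)) : Prop :=
  S.image proj = A ∧ S.card = 4 ∧ (signPart 1 S).card = 2 ∧ (signPart (-1) S).card = 2

theorem isBalancedLift_quarterLift (ε : ℤˣ) {u w k : ZMod n}
    (h : ({u, u + 2 * k, w, w + k} : Finset (ZMod n)).card = 4) :
    IsBalancedLift (quarterLift ε u w k) {u, u + 2 * k, w, w + k} :=
  ⟨image_proj_quarterLift .., card_quarterLift ε h, card_signPart_quarterLift ε 1 h,
    card_signPart_quarterLift ε (-1) h⟩

/-- A quarter set and a quadruple homometric to it have balanced lifts with equal interval vectors. -/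
theorem exists_balancedLift_of_isQuarterSet {A B : Finset (ZMod n)} (hA : A.card = 4)
    (hB : IsQuarterSet B) (h : iv A = iv B) :
    ∃ S T : Finset (Dih n), IsBalancedLift S A ∧ IsBalancedLift T B ∧ rightIv S = rightIv T := by
  obtain ⟨cB, u, w, k, hk, rfl⟩ := hB
  obtain ⟨p, q, rfl, hpq⟩ := exists_quarter_form hk cB hA h
  -- the sign is chosen so that the intervals between opposite signs fill the same coset
  obtain ⟨ε, hε⟩ : ∃ ε : ℤˣ, SameCoset k (w - u) (act ε (q - p)) := by
    rcases hpq with H | H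
    · exact ⟨1, by rwa [act_one]⟩
    · exact ⟨-1, by rwa [act_neg_one, neg_sub]⟩
  refine ⟨quarterLift ε p q k, quarterLift 1 u w k, isBalancedLift_quarterLift ε hA,
    isBalancedLift_quarterLift 1 cB, ?_⟩
  funext ⟨c, η⟩
  rcases Int.units_eq_one_or η with rfl | rfl
  · rw [rightIv_quarterLift_one ε hk hA, rightIv_quarterLift_one 1 hk cB]
  · rw [rightIv_quarterLift_neg_one ε hk hA, rightIv_quarterLift_neg_one 1 hk cB, act_one,
      hit_sum_of_sameCoset hk hε]

/-- Two lifts of single sets extend to a lift of all sets. -/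
theorem exists_isLift {A B : Finset (ZMod n)} (hAB : A ≠ B) {S T : Finset (Dih n)}
    (hS : S.image proj = A) (hT : T.image proj = B) :
    ∃ l : Finset (ZMod n) → Finset (Dih n), IsLift l ∧ l A = S ∧ l B = T := by
  refine ⟨Function.update (Function.update positiveLift A S) B T, fun C => ?_, ?_, ?_⟩
  · by_cases hB : C = B
    · subst hB
      rwa [Function.update_self]
    · rw [Function.update_of_ne hB]
      by_cases hA : C = A
      · subst hA
        rwa [Function.update_self]
      · rw [Function.update_of_ne hA, image_proj_positiveLift]
  · rw [Function.update_of_ne hAB, Function.update_self]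
  · rw [Function.update_self]

end Dih

/-- Non-trivially homometric quadruples lie in cosets of the subgroup of order `13`, or one of them
is a quarter set. -/
theorem thirteen_or_quarter [NeZero n] {A B : Finset (ZMod n)} (hA : A.card = 4)
    (hB : B.card = 4) (h : NontriviallyHomometric A B) :
    (∀ x ∈ A, ∀ y ∈ A, 13 * (x - y) = 0) ∨ IsQuarterSet A ∨ IsQuarterSet B := by
  have hiv := h.1
  have hnc : ¬ Congruent A B := h.2
  obtain ⟨a, ha, rfl⟩ := exists_injective_image_eq hA
  obtain ⟨b, hb, rfl⟩ := exists_injective_image_eq hB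
  by_cases hs : ShareTriangle a b
  · obtain ⟨i, j, k, hij, hjk, hki, p, q, r, hpq, hqr, hrp, h1, h2, h3⟩ := hs
    exact .inr (.inl ((quarter_or_congruent_of_triangle ha hb hiv hpq hqr hrp hij hjk hki
      h1 h2 h3).resolve_left hnc))
  · rcases thirteen_or_quarter_of_not_shareTriangle ha hb hiv hs with h13 | hq
    · left
      intro x hx y hy
      have pos := (iv_pos_iff _ (x - y)).2 ⟨y, hy, x, hx, rfl⟩
      rw [hiv] at pos
      obtain ⟨x', hx', y', hy', e⟩ := (iv_pos_iff _ _).1 pos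
      obtain ⟨i, -, rfl⟩ := Finset.mem_image.1 hx'
      obtain ⟨j, -, rfl⟩ := Finset.mem_image.1 hy'
      rw [← e]
      exact h13 j i
    · exact .inr (.inr hq)

namespace Dih

/-- Non-trivially homometric quadruples have lifts with equal interval vectors and one sign per
element, balanced unless the quadruples lie in cosets of the subgroup of order `13`. -/
theorem exists_lifts_of_nontriviallyHomometric [NeZero n] {A B : Finset (ZMod n)}
    (hA : A.card = 4) (hB : B.card = 4) (h : NontriviallyHomometric A B) :
    ∃ S T : Finset (Dih n), S.image proj = A ∧ T.image proj = B ∧ rightIv S = rightIv T ∧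
      S.card = 4 ∧ T.card = 4 ∧
      ((∃ x ∈ A, ∃ y ∈ A, 13 * (x - y) ≠ 0) → IsBalancedLift S A ∧ IsBalancedLift T B) := by
  rcases thirteen_or_quarter hA hB h with h13 | hq | hq
  · refine ⟨positiveLift A, positiveLift B, image_proj_positiveLift A, image_proj_positiveLift B,
      ?_, ?_, ?_, fun ⟨x, hx, y, hy, hxy⟩ => absurd (h13 x hx y hy) hxy⟩
    · funext g
      rw [rightIv_positiveLift, rightIv_positiveLift, h.1]
    · rw [card_positiveLift, hA]
    · rw [card_positiveLift, hB]
  · obtain ⟨T, S, hT, hS, e⟩ := exists_balancedLift_of_isQuarterSet hB hq h.1.symm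
    exact ⟨S, T, hS.1, hT.1, e.symm, hS.2.1, hT.2.1, fun _ => ⟨hS, hT⟩⟩
  · obtain ⟨S, T, hS, hT, e⟩ := exists_balancedLift_of_isQuarterSet hA hq h.1
    exact ⟨S, T, hS.1, hT.1, e, hS.2.1, hT.2.1, fun _ => ⟨hS, hT⟩⟩

end Dih

end Homometry

theorem mainTheorem7 (N : ℕ) (hN : 2 ≤ N) (A B : Finset (ZMod (4 * N)))
    (hA : A.card = 4) (hB : B.card = 4) (hAB : Homometry.NontriviallyHomometric A B) :
    ∃ l : Finset (ZMod (4 * N)) → Finset (Homometry.Dih (4 * N)),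
      Homometry.Dih.IsLift l ∧
      Homometry.Dih.NontriviallyRightHomometric (l A) (l B) ∧
      -- each element of `A` and of `B` receives exactly one sign
      (l A).card = 4 ∧ (l B).card = 4 ∧
      -- unless all differences in `A` lie in the subgroup of order 13, both signs are used evenly
      ((∃ x ∈ A, ∃ y ∈ A, 13 * (x - y) ≠ 0) →
        (Homometry.Dih.signPart 1 (l A)).card = 2 ∧
        (Homometry.Dih.signPart (-1) (l A)).card = 2 ∧
        (Homometry.Dih.signPart 1 (l B)).card = 2 ∧
        (Homometry.Dih.signPart (-1) (l B)).card = 2) := by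
  have : NeZero (4 * N) := ⟨by omega⟩
  have hne : A ≠ B := fun e => hAB.2 ⟨0, .inl (e ▸ Homometry.transposition_zero A)⟩
  obtain ⟨S, T, hS, hT, hST, cS, cT, hbal⟩ :=
    Homometry.Dih.exists_lifts_of_nontriviallyHomometric hA hB hAB
  obtain ⟨l, hl, rfl, rfl⟩ := Homometry.Dih.exists_isLift hne hS hT
  refine ⟨l, hl, Homometry.Dih.nontriviallyRightHomometric_of_proj hST (by rwa [hS, hT]), cS, cT,
    fun h => ?_⟩
  obtain ⟨⟨-, -, h1, h2⟩, -, -, h3, h4⟩ := hbal h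
  exact ⟨h1, h2, h3, h4⟩
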